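/- Let $G$ be a countable discrete group. An action of $G$ by homeomorphisms on a nonempty compact Hausdorff space $X$ is a boundary action if it is minimal and if, for every regular Borel probability measure $\nu$ on $X$, the weak* closure of the orbit $\{g_*\nu \mid g\in G\}$ contains a point measure; it is topologically free if, for every $g\in G\setminus\{e\}$, the set $\{x\in X\mid gx=x\}$ has empty interior. A subgroup $H$ of $G$ is weakly parabolic if there is a topologically free boundary action of $G$ on some $X$ such that $X$ carries an $H$-invariant regular Borel probability measure. For a unitary representation $\pi$ of $G$ on a Hilbert space $\mathcal H$, let $C^*_\pi(G)$ be the norm closure of the linear span of $\pi(G)$ in $\mathcal B(\mathcal H)$; let $\lambda_G$ be the left regular representation on $\ell^2(G)$ and $C^*_{\rm red}(G)=C^*_{\lambda_G}(G)$. For a unitary representation $\sigma$ of $H$ on a Hilbert space $\mathcal K$, the induced representation $\operatorname{Ind}_H^G\sigma$ acts by left translation $(\pi(g)F)(x)=F(g^{-1}x)$ on the Hilbert space of maps $F:G\to\mathcal K$ with $F(xh)=\sigma(h^{-1})F(x)$ for $x\in G$, $h\in H$ and $\sum_{x\in G/H}\|F(x)\|^2<\infty$. Theorem. Let $H$ be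 a weakly parabolic subgroup of $G$, let $\sigma$ be a unitary representation of $H$ on a nonzero Hilbert space, and let $\pi=\operatorname{Ind}_H^G\sigma$. Then the map $\pi(g)\mapsto\lambda_G(g)$, $g\in G$, extends to a surjective $*$-homomorphism $C^*_\pi(G)\to C^*_{\rm red}(G)$, and its kernel is the (unique) largest proper closed two-sided ideal of $C^*_\pi(G)$: it is a proper closed two-sided ideal and contains every proper closed two-sided ideal of $C^*_\pi(G)$. -/

import Mathlib

open MeasureTheory
open scoped InnerProductSpace

universe u v w

noncomputable section

namespace IndRep

/-! ### Unitary representations and their C*-algebras -/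

/-- Unitary representations of a (discrete) group `G` on a complex Hilbert space `E`. -/
abbrev UnitaryRep (G : Type u) [Group G] (E : Type w) [NormedAddCommGroup E]
    [InnerProductSpace ℂ E] [CompleteSpace E] : Type (max u w) :=
  G →* unitary (E →L[ℂ] E)

section CStar

variable {G : Type u} [Group G] {E : Type w} [NormedAddCommGroup E]
  [InnerProductSpace ℂ E] [CompleteSpace E]

/-- A group homomorphism into the linear isometries of `E` is a unitary representation: the
isometry `T g` is invertible with inverse `T g⁻¹`. -/
def UnitaryRep.ofIsometries (T : G →* (E →ₗᵢ[ℂ] E)) : UnitaryRep G E :=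
  (Unitary.linearIsometryEquiv (𝕜 := ℂ) (H := E)).symm.toMonoidHom.comp
    { toFun := fun g =>
        { (T g) with
          invFun := T g⁻¹
          left_inv := fun x => by
            change (T g⁻¹ * T g) x = x
            rw [← map_mul]; simp
          right_inv := fun x => by
            change (T g * T g⁻¹) x = x
            rw [← map_mul]; simp }
      map_one' := by
        ext x
        change T 1 x = x
        simp
      map_mul' := fun g h => by
        ext x
        change T (g * h) x = (T g * T h) x
        rw [map_mul] }

theorem UnitaryRep.ofIsometries_apply (T : G →* (E →ₗᵢ[ℂ] E)) (g : G) (x : E) :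
    ((UnitaryRep.ofIsometries T g : unitary (E →L[ℂ] E)) : E →L[ℂ] E) x = T g x := rfl

/-- The extension of a unitary representation `π` to the group algebra,
`π(f) = ∑ f(s) π(s)`. -/
def UnitaryRep.onGroupAlgebra (π : UnitaryRep G E) :
    MonoidAlgebra ℂ G →ₐ[ℂ] (E →L[ℂ] E) :=
  MonoidAlgebra.lift ℂ (E →L[ℂ] E) G ((unitary (E →L[ℂ] E)).subtype.comp π)

theorem UnitaryRep.onGroupAlgebra_single (π : UnitaryRep G E) (g : G) (c : ℂ) :
    π.onGroupAlgebra (MonoidAlgebra.single g c) = c • (π g : E →L[ℂ] E) := by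
  simp [UnitaryRep.onGroupAlgebra]

theorem UnitaryRep.star_onGroupAlgebra_mem (π : UnitaryRep G E) (f : MonoidAlgebra ℂ G) :
    star (π.onGroupAlgebra f) ∈ π.onGroupAlgebra.range := by
  induction f using MonoidAlgebra.induction_linear with
  | zero => simp
  | add f₁ f₂ h₁ h₂ => rw [map_add, star_add]; exact add_mem h₁ h₂
  | single g c =>
    refine ⟨MonoidAlgebra.single g⁻¹ (star c), ?_⟩
    change π.onGroupAlgebra (MonoidAlgebra.single g⁻¹ (star c)) = _
    rw [π.onGroupAlgebra_single, π.onGroupAlgebra_single, star_smul, map_inv,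
      ← Unitary.star_eq_inv, Unitary.coe_star]

/-- The `*`-algebra `{π(f) | f ∈ ℂ[G]}` of operators on `E`. -/
def UnitaryRep.groupStarAlgebra (π : UnitaryRep G E) : StarSubalgebra ℂ (E →L[ℂ] E) :=
  { π.onGroupAlgebra.range with
    star_mem' := by
      rintro _ ⟨f, rfl⟩
      exact π.star_onGroupAlgebra_mem f }

/-- `C*_π(G)`: the norm closure of `{π(f) | f ∈ ℂ[G]}` in the bounded operators on `E`. -/
def UnitaryRep.cstar (π : UnitaryRep G E) : StarSubalgebra ℂ (E →L[ℂ] E) :=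
  π.groupStarAlgebra.topologicalClosure

theorem UnitaryRep.mem_cstar (π : UnitaryRep G E) (g : G) :
    (π g : E →L[ℂ] E) ∈ π.cstar :=
  StarSubalgebra.le_topologicalClosure _
    ⟨MonoidAlgebra.single g 1, (π.onGroupAlgebra_single g 1).trans (one_smul _ _)⟩

/-- The operator `π(g)` as an element of `C*_π(G)`. -/
def UnitaryRep.toCstar (π : UnitaryRep G E) (g : G) : π.cstar :=
  ⟨(π g : E →L[ℂ] E), π.mem_cstar g⟩

end CStar

/-! ### The regular representation -/

section Regular

variable (G : Type u) [Group G]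

/-- Left translation on `ℓ²(G)`: `(λ(g) f)(x) = f(g⁻¹ x)`. -/
def leftTranslation : G →* (lp (fun _ : G => ℂ) 2 →ₗᵢ[ℂ] lp (fun _ : G => ℂ) 2) where
  toFun g :=
    { toFun := fun f => ⟨fun x => f (g⁻¹ * x), by
        have h := lp.memℓp f
        rw [memℓp_gen_iff (by norm_num)] at h
        exact (memℓp_gen_iff (by norm_num)).mpr ((Equiv.mulLeft g⁻¹).summable_iff.mpr h)⟩
      map_add' := fun _ _ => rfl
      map_smul' := fun _ _ => rfl
      norm_map' := fun f => by
        rw [lp.norm_eq_tsum_rpow (by norm_num), lp.norm_eq_tsum_rpow (by norm_num)]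
        congr 1
        exact (Equiv.mulLeft g⁻¹).tsum_eq fun x => ‖f x‖ ^ (2 : ENNReal).toReal }
  map_one' := by
    ext f x
    change f (1⁻¹ * x) = f x
    simp
  map_mul' g h := by
    ext f x
    change f ((g * h)⁻¹ * x) = f (h⁻¹ * (g⁻¹ * x))
    rw [mul_inv_rev, mul_assoc]

/-- The left regular representation `λ_G` on `ℓ²(G)`. -/
def regularRep : UnitaryRep G (lp (fun _ : G => ℂ) 2) :=
  UnitaryRep.ofIsometries (leftTranslation G)

end Regular

/-! ### Induced representations -/

section Induced

variable {G : Type u} [Group G] {H : Subgroup G} {K : Type w} [NormedAddCommGroup K]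
  [InnerProductSpace ℂ K] [CompleteSpace K] (σ : UnitaryRep H K)

/-- The maps `F : G → K` with `F(xh) = σ(h⁻¹) F(x)` and `∑_{x ∈ G/H} ‖F(x)‖² < ∞`. The
equivariance makes `‖F(x)‖` depend on the coset `xH` only, so that the sum may be taken over any
system of representatives; `Quotient.out` chooses one. -/
def indSubmodule : Submodule ℂ (G → K) where
  carrier := {F | (∀ (x : G) (h : H), F (x * h) = (σ h⁻¹ : K →L[ℂ] K) (F x)) ∧
    Summable fun c : G ⧸ H => ‖F c.out‖ ^ 2}
  zero_mem' := by simp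
  add_mem' := by
    rintro F₁ F₂ ⟨h₁, s₁⟩ ⟨h₂, s₂⟩
    refine ⟨fun x h => by simp [h₁, h₂], ?_⟩
    refine Summable.of_nonneg_of_le (fun _ => by positivity) (fun c => ?_)
      ((s₁.add s₂).mul_left 2)
    have h := norm_add_le (F₁ c.out) (F₂ c.out)
    have h0 := norm_nonneg (F₁ c.out + F₂ c.out)
    simp only [Pi.add_apply]
    nlinarith [sq_nonneg (‖F₁ c.out‖ - ‖F₂ c.out‖)]
  smul_mem' := by
    rintro a F ⟨h, s⟩
    refine ⟨fun x k => by simp [h], ?_⟩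
    simpa [norm_smul, mul_pow] using s.mul_left (‖a‖ ^ 2)

/-- The Hilbert space of `Ind_H^G σ`. (A type of its own, so that it does not inherit the product
topology of `G → K`.) -/
def IndSpace : Type (max u w) := indSubmodule σ

namespace IndSpace

instance : AddCommGroup (IndSpace σ) := inferInstanceAs (AddCommGroup (indSubmodule σ))

instance : Module ℂ (IndSpace σ) := inferInstanceAs (Module ℂ (indSubmodule σ))

variable {σ}

/-- The map `F : G → K` underlying an element of the space of `Ind_H^G σ`. -/
def toFun (F : IndSpace σ) : G → K := F.1

instance : CoeFun (IndSpace σ) (fun _ => G → K) := ⟨toFun⟩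

theorem ext {F₁ F₂ : IndSpace σ} (h : ∀ x, F₁ x = F₂ x) : F₁ = F₂ :=
  Subtype.ext (funext h)

theorem map_mul_right (F : IndSpace σ) (x : G) (h : H) :
    F (x * h) = (σ h⁻¹ : K →L[ℂ] K) (F x) := F.2.1 x h

theorem norm_mul_right (F : IndSpace σ) (x : G) (h : H) : ‖F (x * h)‖ = ‖F x‖ := by
  rw [F.map_mul_right]; exact Unitary.norm_map (σ h⁻¹) (F x)

theorem norm_out (F : IndSpace σ) (x : G) : ‖F (x : G ⧸ H).out‖ = ‖F x‖ := by
  obtain ⟨h, hh⟩ := QuotientGroup.mk_out_eq_mul H x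
  rw [hh, F.norm_mul_right]

variable (σ) in
/-- Restriction to the chosen representatives identifies the space of `Ind_H^G σ` with
`ℓ²(G/H, K)`. -/
def toLp : IndSpace σ →ₗ[ℂ] lp (fun _ : G ⧸ H => K) 2 where
  toFun F := ⟨fun c => F c.out, by
    refine (memℓp_gen_iff (by norm_num)).mpr ?_
    have h : Summable fun c : G ⧸ H => ‖F c.out‖ ^ 2 := F.2.2
    simpa using h⟩
  map_add' _ _ := rfl
  map_smul' _ _ := rfl

theorem toLp_apply (F : IndSpace σ) (c : G ⧸ H) : toLp σ F c = F c.out := rfl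

theorem toLp_injective : Function.Injective (toLp σ) := by
  intro F₁ F₂ h
  refine ext fun x => ?_
  obtain ⟨k, hk⟩ := QuotientGroup.mk_out_eq_mul H x
  have hx : x = (x : G ⧸ H).out * ((k⁻¹ : H) : G) := by rw [hk]; simp
  rw [hx, F₁.map_mul_right, F₂.map_mul_right, ← toLp_apply, ← toLp_apply, h]

theorem toLp_surjective : Function.Surjective (toLp σ) := by
  intro f
  have key : ∀ x : G, x⁻¹ * (x : G ⧸ H).out ∈ H := fun x => by
    rw [← QuotientGroup.eq, QuotientGroup.out_eq']
  have hout : ∀ c : G ⧸ H, (⟨_, key c.out⟩ : H) = 1 := fun c => by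
    ext
    simp
  refine ⟨⟨fun x => (σ ⟨_, key x⟩ : K →L[ℂ] K) (f x), ?_, ?_⟩, ?_⟩
  · intro x h
    have e : (⟨_, key (x * h)⟩ : H) = h⁻¹ * ⟨_, key x⟩ := by
      ext
      simp [mul_assoc]
    have e' : ((x * h : G) : G ⧸ H) = x := by simp
    change (σ ⟨_, key (x * h)⟩ : K →L[ℂ] K) (f ((x * h : G) : G ⧸ H)) =
      (σ h⁻¹ : K →L[ℂ] K) ((σ ⟨_, key x⟩ : K →L[ℂ] K) (f x))
    rw [e, map_mul, e']
    rfl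
  · have h := lp.memℓp f
    rw [memℓp_gen_iff (by norm_num)] at h
    refine h.congr fun c => ?_
    change _ = ‖(σ ⟨_, key c.out⟩ : K →L[ℂ] K) (f (c.out : G ⧸ H))‖ ^ 2
    rw [hout, map_one, QuotientGroup.out_eq']
    simp
  · ext c
    change (σ ⟨_, key c.out⟩ : K →L[ℂ] K) (f (c.out : G ⧸ H)) = f c
    rw [hout, map_one, QuotientGroup.out_eq']
    simp

/-- The inner product `⟪F₁, F₂⟫ = ∑_{x ∈ G/H} ⟪F₁(x), F₂(x)⟫`. -/
instance : Inner ℂ (IndSpace σ) := ⟨fun F₁ F₂ => ∑' c : G ⧸ H, ⟪F₁ c.out, F₂ c.out⟫_ℂ⟩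

theorem inner_def (F₁ F₂ : IndSpace σ) :
    ⟪F₁, F₂⟫_ℂ = ∑' c : G ⧸ H, ⟪F₁ c.out, F₂ c.out⟫_ℂ := rfl

theorem inner_eq_toLp (F₁ F₂ : IndSpace σ) : ⟪F₁, F₂⟫_ℂ = ⟪toLp σ F₁, toLp σ F₂⟫_ℂ :=
  (lp.inner_eq_tsum (𝕜 := ℂ) (toLp σ F₁) (toLp σ F₂)).symm

variable (σ) in
/-- The inner product of the space of `Ind_H^G σ` satisfies the axioms. -/
@[reducible]
def core : InnerProductSpace.Core ℂ (IndSpace σ) where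
  inner F₁ F₂ := ⟪F₁, F₂⟫_ℂ
  conj_inner_symm F₁ F₂ := by rw [inner_eq_toLp, inner_eq_toLp, inner_conj_symm]
  re_inner_nonneg F := by rw [inner_eq_toLp]; exact inner_self_nonneg
  add_left F₁ F₂ F₃ := by simp only [inner_eq_toLp, map_add, inner_add_left]
  smul_left F₁ F₂ a := by simp only [inner_eq_toLp, map_smul, inner_smul_left]
  definite F h := by
    rw [inner_eq_toLp, inner_self_eq_zero] at h
    exact toLp_injective (h.trans (map_zero _).symm)

instance : NormedAddCommGroup (IndSpace σ) := (core σ).toNormedAddCommGroup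

instance : InnerProductSpace ℂ (IndSpace σ) := InnerProductSpace.ofCore (core σ).toCore

theorem norm_toLp (F : IndSpace σ) : ‖toLp σ F‖ = ‖F‖ := by
  rw [norm_eq_sqrt_re_inner (𝕜 := ℂ), norm_eq_sqrt_re_inner (𝕜 := ℂ) F]
  exact congrArg (fun z : ℂ => √(RCLike.re z)) (inner_eq_toLp F F).symm

instance : CompleteSpace (IndSpace σ) := by
  let e : IndSpace σ ≃ₗᵢ[ℂ] lp (fun _ : G ⧸ H => K) 2 :=
    { LinearEquiv.ofBijective (toLp σ) ⟨toLp_injective, toLp_surjective⟩ with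
      norm_map' := norm_toLp }
  exact (completeSpace_congr (e := e.toEquiv) e.isometry.isUniformEmbedding).mpr inferInstance

theorem norm_sq_eq (F : IndSpace σ) : ‖F‖ ^ 2 = ∑' c : G ⧸ H, ‖F c.out‖ ^ 2 := by
  have h := lp.norm_rpow_eq_tsum (p := 2) (by norm_num) (toLp σ F)
  rw [norm_toLp] at h
  simpa [toLp_apply] using h

theorem norm_translate_out (F : IndSpace σ) (g : G) (c : G ⧸ H) :
    ‖F (g⁻¹ * c.out)‖ = ‖F (g⁻¹ • c).out‖ := by
  rw [← F.norm_out (g⁻¹ * c.out)]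
  have : ((g⁻¹ * c.out : G) : G ⧸ H) = g⁻¹ • c := by
    conv_rhs => rw [← QuotientGroup.out_eq' c]
    rfl
  rw [this]

/-- The left translate `x ↦ F(g⁻¹ x)`. -/
def translate (g : G) (F : IndSpace σ) : IndSpace σ :=
  ⟨fun x => F (g⁻¹ * x),
    fun x h => (congrArg F (mul_assoc g⁻¹ x h).symm).trans (F.map_mul_right (g⁻¹ * x) h), by
      have h : Summable fun c : G ⧸ H => ‖F c.out‖ ^ 2 := F.2.2
      have h' := (MulAction.toPerm (α := G) (β := G ⧸ H) g⁻¹).summable_iff.mpr h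
      exact h'.congr fun c => congrArg (· ^ 2) (F.norm_translate_out g c).symm⟩

theorem translate_apply (g : G) (F : IndSpace σ) (x : G) : translate g F x = F (g⁻¹ * x) := rfl

theorem norm_translate (g : G) (F : IndSpace σ) : ‖translate g F‖ = ‖F‖ := by
  rw [← sq_eq_sq₀ (norm_nonneg _) (norm_nonneg _), norm_sq_eq, norm_sq_eq,
    ← (MulAction.toPerm (α := G) (β := G ⧸ H) g⁻¹).tsum_eq fun c : G ⧸ H => ‖F c.out‖ ^ 2]
  exact tsum_congr fun c => congrArg (· ^ 2) (F.norm_translate_out g c)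

variable (σ) in
/-- Left translation on the space of `Ind_H^G σ`: `(π(g) F)(x) = F(g⁻¹ x)`. -/
def translation : G →* (IndSpace σ →ₗᵢ[ℂ] IndSpace σ) where
  toFun g :=
    { toFun := translate g
      map_add' := fun _ _ => rfl
      map_smul' := fun _ _ => rfl
      norm_map' := norm_translate g }
  map_one' := by
    refine LinearIsometry.ext fun F => ext fun x => ?_
    change F (1⁻¹ * x) = F x
    rw [inv_one, one_mul]
  map_mul' g h := by
    refine LinearIsometry.ext fun F => ext fun x => ?_
    change F ((g * h)⁻¹ * x) = F (h⁻¹ * (g⁻¹ * x))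
    rw [mul_inv_rev, mul_assoc]

end IndSpace

/-- The induced representation `Ind_H^G σ`. -/
def inducedRep : UnitaryRep G (IndSpace σ) :=
  UnitaryRep.ofIsometries (IndSpace.translation σ)

end Induced

/-! ### Boundary actions and weakly parabolic subgroups -/

section Boundary

variable (G : Type u) [Group G] (X : Type v) [TopologicalSpace X] [MeasurableSpace X]
  [BorelSpace X] [MulAction G X] [ContinuousConstSMul G X]

variable {G X} in
/-- The image `g_*ν` of a Borel probability measure under `x ↦ gx`. -/
def pushforward (g : G) (ν : ProbabilityMeasure X) : ProbabilityMeasure X :=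
  ν.map (continuous_const_smul g).measurable.aemeasurable

/-- Strong proximality: for every (regular Borel) probability measure `ν`, the weak* closure of the
orbit `Gν` contains a point measure. The topology on `ProbabilityMeasure X` is that of convergence
of integrals of bounded continuous functions. -/
def IsStronglyProximal : Prop :=
  ∀ ν : ProbabilityMeasure X, (ν : Measure X).Regular →
    ∃ x : X, diracProba x ∈ closure (Set.range fun g : G => pushforward g ν)

/-- Boundary actions (on a nonempty compact Hausdorff space): minimal and strongly proximal. -/
structure IsBoundaryAction : Prop where
  nonempty : Nonempty X
  minimal : MulAction.IsMinimal G X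
  stronglyProximal : IsStronglyProximal G X

/-- The fixed point set of every `g ≠ 1` has empty interior. -/
def IsTopologicallyFree (G : Type u) [Group G] (X : Type v) [TopologicalSpace X]
    [MulAction G X] : Prop :=
  ∀ g : G, g ≠ 1 → interior (MulAction.fixedBy X g) = ∅

end Boundary

/-- `H` is weakly parabolic in `G`: it fixes a (regular Borel) probability measure on a compact
Hausdorff space `X` with a topologically free boundary action of `G`. -/
def IsWeaklyParabolic {G : Type u} [Group G] (H : Subgroup G) : Prop :=
  ∃ (X : Type v) (_ : TopologicalSpace X) (_ : CompactSpace X) (_ : T2Space X)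
    (_ : MeasurableSpace X) (_ : BorelSpace X) (_ : MulAction G X)
    (_ : ContinuousConstSMul G X),
    IsBoundaryAction G X ∧ IsTopologicallyFree G X ∧
      ∃ ν : ProbabilityMeasure X, (ν : Measure X).Regular ∧ ∀ h ∈ H, pushforward h ν = ν

end IndRep

end

/-!
The proof moves states around on the boundary `X`. Integrating against the `H`-invariant measure
turns a function on `X` into a function on `G ⧸ H` (its Poisson transform), which acts on the space
of `Ind_H^G σ` by multiplication; this is a unital positive `G`-equivariant map from `C(X)` to the
bounded operators. A state of `B(Ind_H^G σ)` thereby becomes a measure on `X`. Given a proper ideal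
`I` of `C*_π(G)`, start from a state vanishing on `I`: conjugating by `π(g)` moves its measure by
`g`, so weak* limits of conjugates, which still vanish on `I`, can be given the measure `δ_x` for
any `x`. Such a state kills `π(g)` whenever `gx ≠ x`, so topological freeness and compactness yield
a state vanishing on `I` and on all `π(g)` with `g ≠ 1`. It restricts to the canonical trace of the
group algebra, whose GNS representation is `λ_G`. Applied to `I = 0` this gives `π(g) ↦ λ_G(g)`;
for arbitrary `I`, faithfulness of the trace on `C*_red(G)` shows that `I` lies in the kernel.
-/

noncomputable section

namespace IndRep

/-! ### States -/

section States

open scoped ComplexOrder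

/-- States of a unital normed algebra, as contractive unital functionals; over a C*-algebra these
are the positive unital functionals, see `IsState.toPositiveLinearMap`. -/
structure IsState {B : Type*} [NormedRing B] [NormedAlgebra ℂ B] (φ : WeakDual ℂ B) : Prop where
  norm_apply_le : ∀ b, ‖φ b‖ ≤ ‖b‖
  map_one : φ 1 = 1

/-- The states of `B` which vanish on `S`, as a subspace of the weak* dual. -/
def statesVanishingOn {B : Type*} [NormedRing B] [NormedAlgebra ℂ B] (S : Set B) :
    Set (WeakDual ℂ B) :=
  {φ | IsState φ ∧ ∀ b ∈ S, φ b = 0}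

section NormedAlgebra

variable {B : Type*} [NormedRing B] [NormedAlgebra ℂ B]

theorem isCompact_statesVanishingOn (S : Set B) : IsCompact (statesVanishingOn S) := by
  have hclosed : IsClosed (statesVanishingOn S) := by
    have : statesVanishingOn S = (⋂ b : B, {φ : WeakDual ℂ B | ‖φ b‖ ≤ ‖b‖}) ∩
        {φ : WeakDual ℂ B | φ 1 = 1} ∩ ⋂ b ∈ S, {φ : WeakDual ℂ B | φ b = 0} := by
      ext φ
      simp only [statesVanishingOn, Set.mem_ofPred_eq, Set.mem_inter_iff, Set.mem_iInter]
      exact and_congr_left' ⟨fun h => ⟨h.1, h.2⟩, fun h => ⟨h.1, h.2⟩⟩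
    rw [this]
    have hev := WeakDual.eval_continuous (𝕜 := ℂ) (E := B)
    exact ((isClosed_iInter fun b => isClosed_le (hev b).norm continuous_const).inter
      (isClosed_eq (hev 1) continuous_const)).inter
        (isClosed_biInter fun b _ => isClosed_eq (hev b) continuous_const)
  refine (WeakDual.isCompact_closedBall (0 : StrongDual ℂ B) 1).of_isClosed_subset hclosed ?_
  intro φ hφ
  rw [Set.mem_preimage, mem_closedBall_zero_iff]
  exact ContinuousLinearMap.opNorm_le_bound _ zero_le_one fun b =>
    (hφ.1.norm_apply_le b).trans_eq (one_mul _).symm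

/-- Hahn–Banach: the functional is obtained on the quotient by `S`, where `1` has norm `1`. -/
theorem exists_isState_forall_mem_eq_zero [NormOneClass B] (S : Submodule ℂ B)
    (hS : ∀ s ∈ S, 1 ≤ ‖1 - s‖) : ∃ φ : WeakDual ℂ B, IsState φ ∧ ∀ s ∈ S, φ s = 0 := by
  have hnorm : ‖(S.mkQL 1 : B ⧸ S)‖ = 1 := by
    refine le_antisymm ((Submodule.Quotient.norm_mk_le S 1).trans_eq norm_one) ?_
    refine QuotientAddGroup.le_norm_iff.mpr fun m hm => ?_
    simpa using hS _ ((Submodule.Quotient.eq S).mp hm.symm)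
  obtain ⟨f, hf, hf1⟩ := exists_dual_vector'' ℂ (S.mkQL 1 : B ⧸ S)
  refine ⟨(f.comp S.mkQL : StrongDual ℂ B), ⟨fun b => ?_, ?_⟩, fun s hs => ?_⟩
  · calc ‖f (S.mkQL b)‖ ≤ 1 * ‖S.mkQL b‖ := f.le_of_opNorm_le hf _
      _ ≤ ‖b‖ := (one_mul _).trans_le (Submodule.Quotient.norm_mk_le S b)
  · exact hf1.trans (by rw [hnorm, RCLike.ofReal_one])
  · exact (congrArg f ((Submodule.Quotient.mk_eq_zero S).mpr hs)).trans (map_zero f)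

theorem one_le_norm_one_sub_of_mem {A : Type*} [NormedRing A] [CompleteSpace A]
    {I : TwoSidedIdeal A} (hI : I ≠ ⊤) {a : A} (ha : a ∈ I) : 1 ≤ ‖1 - a‖ := by
  by_contra! hlt
  have hunit : IsUnit a := by simpa using isUnit_one_sub_of_norm_lt_one hlt
  obtain ⟨b, hb⟩ := hunit.exists_left_inv
  exact hI (I.one_mem_iff.mp (hb ▸ I.mul_mem_left b a ha))

theorem nonempty_statesVanishingOn [NormOneClass B] (A : Subalgebra ℂ B) [CompleteSpace A]
    {I : TwoSidedIdeal A} (hI : I ≠ ⊤) :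
    (statesVanishingOn (Subtype.val '' (I : Set A))).Nonempty := by
  let S : Submodule ℂ B := (I.asIdeal.restrictScalars ℂ).map A.val.toLinearMap
  obtain ⟨φ, hφ, hφS⟩ := exists_isState_forall_mem_eq_zero S <| by
    rintro _ ⟨a, ha, rfl⟩
    exact one_le_norm_one_sub_of_mem hI (TwoSidedIdeal.mem_asIdeal.mp ha)
  refine ⟨φ, hφ, ?_⟩
  rintro _ ⟨a, ha, rfl⟩
  exact hφS _ ⟨a, TwoSidedIdeal.mem_asIdeal.mpr ha, rfl⟩

end NormedAlgebra

section CStarAlgebra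

variable {B : Type*} [CStarAlgebra B]

theorem norm_add_smul_I_sq_le {a : B} (ha : IsSelfAdjoint a) (t : ℝ) :
    ‖a + (t * Complex.I) • (1 : B)‖ ^ 2 ≤ ‖a‖ ^ 2 + t ^ 2 * ‖(1 : B)‖ := by
  have hstar : star (a + (t * Complex.I) • (1 : B)) = a - (t * Complex.I) • (1 : B) := by
    simp [ha.star_eq, sub_eq_add_neg]
  have hmul : star (a + (t * Complex.I) • (1 : B)) * (a + (t * Complex.I) • (1 : B)) =
      a * a + (t ^ 2 : ℝ) • (1 : B) := by
    have hI : (t * Complex.I) * (t * Complex.I) = -((t ^ 2 : ℝ) : ℂ) := by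
      push_cast
      linear_combination (t : ℂ) ^ 2 * Complex.I_mul_I
    rw [hstar, sub_mul, mul_add, mul_add]
    simp only [smul_mul_assoc, mul_smul_comm, one_mul, mul_one, smul_smul, hI]
    rw [neg_smul, Complex.coe_smul]
    abel
  calc ‖a + (t * Complex.I) • (1 : B)‖ ^ 2 = ‖a * a + (t ^ 2 : ℝ) • (1 : B)‖ := by
        rw [sq, ← CStarRing.norm_star_mul_self, hmul]
    _ ≤ ‖a * a‖ + ‖(t ^ 2 : ℝ) • (1 : B)‖ := norm_add_le _ _
    _ = ‖a‖ ^ 2 + t ^ 2 * ‖(1 : B)‖ := by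
        rw [ha.norm_mul_self, norm_smul, Real.norm_of_nonneg (sq_nonneg t)]

theorem exists_mem_statesVanishingOn_conj {S : Set B} {φ : WeakDual ℂ B}
    (hφ : φ ∈ statesVanishingOn S) (u : unitary B) (hS : ∀ b ∈ S, star (u : B) * b * u ∈ S) :
    ∃ ψ ∈ statesVanishingOn S, ∀ b, ψ b = φ (star (u : B) * b * u) := by
  let c : B →L[ℂ] B := ContinuousLinearMap.mulLeftRight ℂ B (star (u : B)) u
  have hc (b : B) : c b = star (u : B) * b * u :=
    ContinuousLinearMap.mulLeftRight_apply ℂ B _ _ _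
  refine ⟨(φ : StrongDual ℂ B).comp c, ⟨⟨fun b => ?_, ?_⟩, fun b hb => ?_⟩, fun b => ?_⟩
  · refine (hφ.1.norm_apply_le (c b)).trans_eq ?_
    rw [hc, CStarRing.norm_mul_coe_unitary, ← Unitary.coe_star, CStarRing.norm_coe_unitary_mul]
  · refine (congrArg φ (hc 1)).trans ?_
    rw [mul_one, Unitary.coe_star_mul_self, hφ.1.map_one]
  · exact (congrArg φ (hc b)).trans (hφ.2 _ (hS b hb))
  · exact congrArg φ (hc b)

namespace IsState

variable {φ : WeakDual ℂ B}

protected theorem nontrivial (hφ : IsState φ) : Nontrivial B :=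
  ⟨1, 0, fun h => one_ne_zero (α := ℂ) (by rw [← hφ.map_one, h, map_zero])⟩

theorem im_apply_eq_zero (hφ : IsState φ) {a : B} (ha : IsSelfAdjoint a) : (φ a).im = 0 := by
  have := hφ.nontrivial
  have key (t : ℝ) : ((φ a).im + t) ^ 2 ≤ ‖a‖ ^ 2 + t ^ 2 := by
    have him : (φ (a + (t * Complex.I) • (1 : B))).im = (φ a).im + t := by
      simp [hφ.map_one]
    calc ((φ a).im + t) ^ 2 ≤ ‖a + (t * Complex.I) • (1 : B)‖ ^ 2 := by
          rw [← him, ← sq_abs]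
          gcongr
          exact (Complex.abs_im_le_norm _).trans (hφ.norm_apply_le _)
      _ ≤ ‖a‖ ^ 2 + t ^ 2 := (norm_add_smul_I_sq_le ha t).trans_eq (by simp)
  by_contra hne
  have h := key ((‖a‖ ^ 2 + 1) / (2 * (φ a).im))
  have hcancel : 2 * (φ a).im * ((‖a‖ ^ 2 + 1) / (2 * (φ a).im)) = ‖a‖ ^ 2 + 1 := by
    field_simp
  nlinarith [sq_nonneg (φ a).im]

variable [PartialOrder B] [StarOrderedRing B]

theorem apply_nonneg (hφ : IsState φ) {b : B} (hb : 0 ≤ b) : 0 ≤ φ b := by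
  have := hφ.nontrivial
  have hle : ‖algebraMap ℝ B ‖b‖ - b‖ ≤ ‖b‖ := by
    have hb' := (IsSelfAdjoint.of_nonneg hb).le_algebraMap_norm_self
    simpa using CStarAlgebra.norm_le_norm_of_nonneg_of_le (sub_nonneg.mpr hb') (sub_le_self _ hb)
  have hre : ‖b‖ - (φ b).re ≤ ‖b‖ := by
    have h := (Complex.re_le_norm _).trans ((hφ.norm_apply_le _).trans hle)
    rwa [map_sub, Algebra.algebraMap_eq_smul_one, ← Complex.coe_smul, map_smul, hφ.map_one,
      smul_eq_mul, mul_one, Complex.sub_re, Complex.ofReal_re] at h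
  exact Complex.nonneg_iff.mpr
    ⟨by linarith, (hφ.im_apply_eq_zero (IsSelfAdjoint.of_nonneg hb)).symm⟩

/-- A state as a positive linear functional. -/
def toPositiveLinearMap (hφ : IsState φ) : B →ₚ[ℂ] ℂ :=
  PositiveLinearMap.mk₀ (φ : B →ₗ[ℂ] ℂ) fun _ => hφ.apply_nonneg

end IsState

end CStarAlgebra

section PositiveFunctional

variable {A : Type*} [NonUnitalCStarAlgebra A] [PartialOrder A] [StarOrderedRing A]

theorem norm_toPreGNS_mul_le (f : A →ₚ[ℂ] ℂ) (a b : A) :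
    ‖f.toPreGNS (a * b)‖ ≤ ‖a‖ * ‖f.toPreGNS b‖ :=
  (f.leftMulMapPreGNS a).le_of_opNorm_le (LinearMap.mkContinuous_norm_le _ (norm_nonneg a) _)
    (f.toPreGNS b)

theorem map_mul_eq_zero_of_map_left_eq_zero (f : A →ₚ[ℂ] ℂ) {a : A} (ha : 0 ≤ a) (hfa : f a = 0)
    (b : A) : f (a * b) = 0 := by
  have hsq : CFC.sqrt a * CFC.sqrt a = a := CFC.sqrt_mul_sqrt_self a
  have hsa : star (CFC.sqrt a) = CFC.sqrt a := (CFC.sqrt_nonneg a).isSelfAdjoint.star_eq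
  have hnull : ‖f.toPreGNS (CFC.sqrt a)‖ = 0 := by
    rw [f.preGNS_norm_def, f.ofPreGNS_toPreGNS, hsa, hsq, hfa, Complex.zero_re, Real.sqrt_zero]
  have hcs := norm_inner_le_norm (𝕜 := ℂ) (f.toPreGNS (CFC.sqrt a)) (f.toPreGNS (CFC.sqrt a * b))
  rw [hnull, zero_mul, f.preGNS_inner_def, f.ofPreGNS_toPreGNS, f.ofPreGNS_toPreGNS, hsa,
    ← mul_assoc, hsq] at hcs
  exact norm_le_zero_iff.mp hcs

theorem map_mul_eq_zero_of_map_right_eq_zero (f : A →ₚ[ℂ] ℂ) {a : A} (ha : 0 ≤ a)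
    (hfa : f a = 0) (b : A) : f (b * a) = 0 := by
  have h := map_mul_eq_zero_of_map_left_eq_zero f ha hfa (star b)
  rwa [← ha.isSelfAdjoint.star_eq, ← star_mul, map_star, star_eq_zero] at h

end PositiveFunctional

end States

/-! ### Star homomorphisms with dense range -/

section DenseRange

open scoped CStarAlgebra

variable {A B : Type*} [CStarAlgebra A] [CStarAlgebra B]

/-- The lift is obtained by truncating `a`, by functional calculus, at the height `‖Φ a‖`. -/
theorem exists_lift_norm_le_of_isSelfAdjoint (Φ : A →⋆ₐ[ℂ] B) {a : A} (ha : IsSelfAdjoint a) :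
    ∃ a' : A, Φ a' = Φ a ∧ ‖a'‖ ≤ ‖Φ a‖ := by
  rcases subsingleton_or_nontrivial B with hB | hB
  · exact ⟨0, Subsingleton.elim _ _, by simp⟩
  let truncate : ℝ → ℝ := fun t => max (-‖Φ a‖) (min t ‖Φ a‖)
  have hcont : Continuous truncate := by fun_prop
  refine ⟨cfc truncate a, ?_, norm_cfc_le (norm_nonneg _) fun t _ => ?_⟩
  · calc Φ (cfc truncate a) = cfc truncate (Φ a) :=
          StarAlgHom.map_cfc Φ truncate a hcont.continuousOn (map_continuous Φ) ha (ha.map Φ)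
      _ = cfc id (Φ a) := cfc_congr fun t ht => by
          have h := abs_le.mp (spectrum.norm_le_norm_of_mem ht)
          simp only [truncate, id, min_eq_left h.2, max_eq_right h.1]
      _ = Φ a := cfc_id ℝ (Φ a) (ha.map Φ)
  · exact abs_le.mpr ⟨le_max_left _ _, max_le (neg_le_self (norm_nonneg _)) (min_le_right _ _)⟩

theorem exists_lift_norm_le (Φ : A →⋆ₐ[ℂ] B) (a : A) :
    ∃ a' : A, Φ a' = Φ a ∧ ‖a'‖ ≤ 2 * ‖Φ a‖ := by
  have hre : Φ (realPart a : A) = (realPart (Φ a) : B) := by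
    simp [realPart_apply_coe, ← Complex.coe_smul, map_star Φ a]
  have him : Φ (imaginaryPart a : A) = (imaginaryPart (Φ a) : B) := by
    simp [imaginaryPart_apply_coe, ← Complex.coe_smul, map_star Φ a]
  obtain ⟨x, hx, hxnorm⟩ := exists_lift_norm_le_of_isSelfAdjoint Φ (realPart a).2
  obtain ⟨y, hy, hynorm⟩ := exists_lift_norm_le_of_isSelfAdjoint Φ (imaginaryPart a).2
  rw [hre] at hxnorm
  rw [him] at hynorm
  refine ⟨x + Complex.I • y, ?_, ?_⟩
  · rw [map_add, map_smul, hx, hy, ← map_smul, ← map_add, realPart_add_I_smul_imaginaryPart]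
  · calc ‖x + Complex.I • y‖ ≤ ‖x‖ + ‖y‖ := (norm_add_le _ _).trans_eq (by simp [norm_smul])
      _ ≤ ‖Φ a‖ + ‖Φ a‖ := add_le_add (hxnorm.trans (realPart.norm_le (Φ a)))
          (hynorm.trans (imaginaryPart.norm_le (Φ a)))
      _ = 2 * ‖Φ a‖ := (two_mul _).symm

theorem surjective_of_denseRange (Φ : A →⋆ₐ[ℂ] B) (hΦ : DenseRange Φ) :
    Function.Surjective Φ := by
  let f : NormedAddGroupHom A B :=
    { toFun := Φ
      map_add' := map_add Φ
      bound' := ⟨1, fun a => (NonUnitalStarAlgHom.norm_apply_le Φ a).trans_eq (one_mul _).symm⟩ }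
  intro b
  have hb : b ∈ (NormedAddGroupHom.incl f.range).range.topologicalClosure := by
    refine closure_mono ?_ (hΦ b)
    rintro _ ⟨a, rfl⟩
    exact ⟨⟨Φ a, a, rfl⟩, rfl⟩
  have hlift (c : f.range) : ∃ a, f a = NormedAddGroupHom.incl f.range c ∧ ‖a‖ ≤ 2 * ‖c‖ := by
    obtain ⟨_, a, rfl⟩ := c
    exact exists_lift_norm_le Φ a
  obtain ⟨a, ha, -⟩ :=
    controlled_closure_range_of_complete (fun _ => rfl) two_pos one_pos hlift b hb
  exact ⟨a, ha⟩

theorem exists_starAlgHom_of_norm_le {R : Type*} [Ring R] [Algebra ℂ R] (e : R →ₐ[ℂ] A)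
    (r : R →ₐ[ℂ] B) (he : DenseRange e) (hle : ∀ x, ‖r x‖ ≤ ‖e x‖)
    (hstar : ∀ x, ∃ y, e y = star (e x) ∧ r y = star (r x)) :
    ∃ Φ : A →⋆ₐ[ℂ] B, ∀ x, Φ (e x) = r x := by
  let T : A →L[ℂ] B := r.toLinearMap.extendOfNorm e.toLinearMap
  have hT (x : R) : T (e x) = r x :=
    LinearMap.extendOfNorm_eq (f := r.toLinearMap) (e := e.toLinearMap) he
      ⟨1, fun x => (hle x).trans_eq (one_mul _).symm⟩ x
  have hone : T 1 = 1 := by rw [← map_one e, hT, map_one]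
  have hmul (a b : A) : T (a * b) = T a * T b := by
    induction a, b using he.induction_on₂ with
    | hp => exact isClosed_eq (by fun_prop) (by fun_prop)
    | h x y => rw [← map_mul e, hT, hT, hT, map_mul r]
  have hstar' (a : A) : T (star a) = star (T a) := by
    induction a using he.induction_on with
    | hp => exact isClosed_eq (by fun_prop) (by fun_prop)
    | ih x =>
      obtain ⟨y, hey, hry⟩ := hstar x
      rw [← hey, hT, hT, hry]
  exact ⟨{ AlgHom.ofLinearMap T.toLinearMap hone hmul with map_star' := hstar' }, hT⟩

end DenseRange

/-! ### Trace states and the reduced C*-algebra -/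

instance {ι : Type*} [Nonempty ι] {F : Type*} [NormedAddCommGroup F] [Nontrivial F]
    (p : ENNReal) : Nontrivial (lp (fun _ : ι => F) p) := by
  classical
  obtain ⟨i⟩ := ‹Nonempty ι›
  obtain ⟨v, hv⟩ := exists_ne (0 : F)
  refine ⟨lp.single p i v, 0, fun h => hv ?_⟩
  simpa using congrArg (fun f : lp (fun _ : ι => F) p => f i) h

section RegularRep

variable (G : Type u) [Group G]

/-- The unit vector `δ_1` of `ℓ²(G)`, whose vector state is the canonical trace of `C*_red(G)`. -/
def deltaOne : lp (fun _ : G => ℂ) 2 :=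
  letI := Classical.decEq G
  lp.single 2 1 1

variable {G}

theorem deltaOne_eq_single [DecidableEq G] : deltaOne G = lp.single 2 1 1 := by
  rw [deltaOne, Subsingleton.elim (Classical.decEq G)]

theorem regularRep_single_deltaOne [DecidableEq G] (g : G) (c : ℂ) :
    (regularRep G).onGroupAlgebra (MonoidAlgebra.single g c) (deltaOne G) = lp.single 2 g c := by
  rw [UnitaryRep.onGroupAlgebra_single, deltaOne_eq_single]
  ext x
  change c * (lp.single 2 (1 : G) (1 : ℂ) : lp (fun _ : G => ℂ) 2) (g⁻¹ * x) = _
  by_cases hx : x = g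
  · simp [lp.single_apply, hx]
  · simp [lp.single_apply, hx, inv_mul_eq_one, Ne.symm hx]

theorem denseRange_regularRep_deltaOne :
    DenseRange fun k : MonoidAlgebra ℂ G => (regularRep G).onGroupAlgebra k (deltaOne G) := by
  classical
  refine fun ξ => mem_closure_of_tendsto (lp.hasSum_single (by norm_num) ξ)
    (Filter.Eventually.of_forall fun s => ⟨∑ g ∈ s, MonoidAlgebra.single g (ξ g), ?_⟩)
  simp only [map_sum, sum_apply, regularRep_single_deltaOne]

theorem ext_regularRep_deltaOne {S T : lp (fun _ : G => ℂ) 2 →L[ℂ] lp (fun _ : G => ℂ) 2}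
    (h : ∀ k, S ((regularRep G).onGroupAlgebra k (deltaOne G)) =
      T ((regularRep G).onGroupAlgebra k (deltaOne G))) : S = T :=
  ContinuousLinearMap.coeFn_injective <|
    denseRange_regularRep_deltaOne.equalizer S.continuous T.continuous (funext h)

end RegularRep

namespace UnitaryRep

variable {G : Type u} [Group G] {E : Type w} [NormedAddCommGroup E]
  [InnerProductSpace ℂ E] [CompleteSpace E] (π : UnitaryRep G E)

instance : IsClosed (π.cstar : Set (E →L[ℂ] E)) :=
  StarSubalgebra.isClosed_topologicalClosure _

/-- `UnitaryRep.onGroupAlgebra` with values in `C*_π(G)`, where its range is dense. -/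
def algHomCstar : MonoidAlgebra ℂ G →ₐ[ℂ] π.cstar :=
  π.onGroupAlgebra.codRestrict π.cstar.toSubalgebra fun f =>
    StarSubalgebra.le_topologicalClosure π.groupStarAlgebra ⟨f, rfl⟩

theorem algHomCstar_single_one (g : G) :
    π.algHomCstar (MonoidAlgebra.single g 1) = π.toCstar g :=
  Subtype.ext ((π.onGroupAlgebra_single g 1).trans (one_smul _ _))

theorem denseRange_algHomCstar : DenseRange π.algHomCstar := by
  rintro ⟨a, ha⟩
  rw [closure_subtype]
  refine closure_mono ?_ ha
  rintro _ ⟨f, rfl⟩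
  exact ⟨π.algHomCstar f, ⟨f, rfl⟩, rfl⟩

theorem star_onGroupAlgebra_single (g : G) (c : ℂ) :
    star (π.onGroupAlgebra (MonoidAlgebra.single g c)) =
      π.onGroupAlgebra (MonoidAlgebra.single g⁻¹ (star c)) := by
  rw [π.onGroupAlgebra_single, π.onGroupAlgebra_single, star_smul, map_inv,
    ← Unitary.star_eq_inv, Unitary.coe_star]

theorem exists_onGroupAlgebra_eq_star {F : Type*} [NormedAddCommGroup F]
    [InnerProductSpace ℂ F] [CompleteSpace F] (ρ : UnitaryRep G F) (f : MonoidAlgebra ℂ G) :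
    ∃ k, π.onGroupAlgebra k = star (π.onGroupAlgebra f) ∧
      ρ.onGroupAlgebra k = star (ρ.onGroupAlgebra f) := by
  induction f using MonoidAlgebra.induction_linear with
  | zero => exact ⟨0, by simp, by simp⟩
  | add f₁ f₂ h₁ h₂ =>
    obtain ⟨k₁, hπ₁, hρ₁⟩ := h₁
    obtain ⟨k₂, hπ₂, hρ₂⟩ := h₂
    exact ⟨k₁ + k₂, by rw [map_add, map_add, star_add, hπ₁, hπ₂],
      by rw [map_add, map_add, star_add, hρ₁, hρ₂]⟩
  | single g c =>
    exact ⟨MonoidAlgebra.single g⁻¹ (star c), (π.star_onGroupAlgebra_single g c).symm,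
      (ρ.star_onGroupAlgebra_single g c).symm⟩

end UnitaryRep

section TraceState

variable {G : Type u} [Group G] {E : Type w} [NormedAddCommGroup E]
  [InnerProductSpace ℂ E] [CompleteSpace E]

/-- States of `B(E)` which restrict to the canonical trace `f ↦ f 1` of the group algebra. -/
structure IsTraceState (π : UnitaryRep G E) (ψ : WeakDual ℂ (E →L[ℂ] E)) : Prop
    extends IsState ψ where
  apply_eq_zero : ∀ g : G, g ≠ 1 → ψ (π g : E →L[ℂ] E) = 0

namespace IsTraceState

variable {π : UnitaryRep G E} {ψ : WeakDual ℂ (E →L[ℂ] E)}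

theorem apply_onGroupAlgebra (hψ : IsTraceState π ψ) (f : MonoidAlgebra ℂ G) :
    ψ (π.onGroupAlgebra f) =
      ⟪deltaOne G, (regularRep G).onGroupAlgebra f (deltaOne G)⟫_ℂ := by
  classical
  induction f using MonoidAlgebra.induction_linear with
  | zero => simp
  | add f₁ f₂ h₁ h₂ => simp only [map_add, h₁, h₂, add_apply, inner_add_right]
  | single g c =>
    rw [regularRep_single_deltaOne, deltaOne_eq_single, lp.inner_single_left,
      π.onGroupAlgebra_single, map_smul]
    by_cases hg : g = 1
    · simp [hg, hψ.map_one]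
    · simp [hψ.apply_eq_zero g hg, lp.single_apply, Ne.symm hg]

theorem norm_regularRep_deltaOne_sq (hψ : IsTraceState π ψ) (k : MonoidAlgebra ℂ G) :
    (‖(regularRep G).onGroupAlgebra k (deltaOne G)‖ : ℂ) ^ 2 =
      ψ (star (π.onGroupAlgebra k) * π.onGroupAlgebra k) := by
  obtain ⟨k', hπ, hlam⟩ := π.exists_onGroupAlgebra_eq_star (regularRep G) k
  rw [← hπ, ← map_mul, hψ.apply_onGroupAlgebra, map_mul, hlam, mul_apply_eq_comp,
    ContinuousLinearMap.star_eq_adjoint, ContinuousLinearMap.adjoint_inner_right]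
  exact (inner_self_eq_norm_sq_to_K (𝕜 := ℂ)
    ((regularRep G).onGroupAlgebra k (deltaOne G))).symm

theorem norm_regularRep_deltaOne (hψ : IsTraceState π ψ) (k : MonoidAlgebra ℂ G) :
    ‖(regularRep G).onGroupAlgebra k (deltaOne G)‖ =
      ‖hψ.toPositiveLinearMap.toPreGNS (π.onGroupAlgebra k)‖ := by
  have h := (hψ.norm_regularRep_deltaOne_sq k).trans
    (hψ.toPositiveLinearMap.preGNS_norm_sq (hψ.toPositiveLinearMap.toPreGNS _)).symm
  exact (sq_eq_sq₀ (norm_nonneg _) (norm_nonneg _)).mp (by exact_mod_cast h)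

theorem norm_regularRep_le (hψ : IsTraceState π ψ) (f : MonoidAlgebra ℂ G) :
    ‖(regularRep G).onGroupAlgebra f‖ ≤ ‖π.onGroupAlgebra f‖ := by
  refine ContinuousLinearMap.opNorm_le_bound _ (norm_nonneg _) fun ξ => ?_
  induction ξ using (denseRange_regularRep_deltaOne (G := G)).induction_on with
  | hp => exact isClosed_le (by fun_prop) (by fun_prop)
  | ih k =>
    rw [← mul_apply_eq_comp, ← map_mul, hψ.norm_regularRep_deltaOne, map_mul,
      hψ.norm_regularRep_deltaOne]
    exact norm_toPreGNS_mul_le _ _ _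

theorem exists_starAlgHom_regularRep (hψ : IsTraceState π ψ) :
    ∃ Φ : π.cstar →⋆ₐ[ℂ] (regularRep G).cstar,
      ∀ f, Φ (π.algHomCstar f) = (regularRep G).algHomCstar f := by
  refine exists_starAlgHom_of_norm_le π.algHomCstar (regularRep G).algHomCstar
    π.denseRange_algHomCstar hψ.norm_regularRep_le fun f => ?_
  obtain ⟨k, hπ, hlam⟩ := π.exists_onGroupAlgebra_eq_star (regularRep G) f
  exact ⟨k, Subtype.ext hπ, Subtype.ext hlam⟩

open scoped CStarAlgebra in
theorem norm_map_deltaOne_sq (hψ : IsTraceState π ψ) {Φ : π.cstar →⋆ₐ[ℂ] (regularRep G).cstar}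
    (hΦ : ∀ f, Φ (π.algHomCstar f) = (regularRep G).algHomCstar f) (b : π.cstar) :
    (‖(Φ b : lp (fun _ : G => ℂ) 2 →L[ℂ] lp (fun _ : G => ℂ) 2) (deltaOne G)‖ : ℂ) ^ 2 =
      ψ ((star b * b : π.cstar) : E →L[ℂ] E) := by
  have hcont : Continuous Φ := map_continuous Φ
  induction b using π.denseRange_algHomCstar.induction_on with
  | hp => exact isClosed_eq (by fun_prop) (by fun_prop)
  | ih f => rw [hΦ]; exact hψ.norm_regularRep_deltaOne_sq f

theorem map_eq_zero_of_mem (hψ : IsTraceState π ψ) {Φ : π.cstar →⋆ₐ[ℂ] (regularRep G).cstar}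
    (hΦ : ∀ f, Φ (π.algHomCstar f) = (regularRep G).algHomCstar f) {I : TwoSidedIdeal π.cstar}
    (hI : ∀ a ∈ I, ψ (a : E →L[ℂ] E) = 0) {a : π.cstar} (ha : a ∈ I) : Φ a = 0 := by
  refine Subtype.ext (ext_regularRep_deltaOne fun k => ?_)
  have h := hψ.norm_map_deltaOne_sq hΦ (a * π.algHomCstar k)
  rw [hI _ (I.mul_mem_left _ _ (I.mul_mem_right _ _ ha)), map_mul, hΦ, sq_eq_zero_iff] at h
  exact norm_eq_zero.mp (Complex.ofReal_eq_zero.mp h)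

end IsTraceState

end TraceState

/-! ### Boundary actions -/

section BoundaryAction

variable {G : Type u} [Group G] {X : Type v} [TopologicalSpace X] [MulAction G X]
  [ContinuousConstSMul G X]

theorem IsTopologicallyFree.exists_forall_mem_smul_ne [T2Space X] [BaireSpace X] [Nonempty X]
    (hX : IsTopologicallyFree G X) {s : Set G} (hs : s.Countable) (h1 : 1 ∉ s) :
    ∃ x : X, ∀ g ∈ s, g • x ≠ x := by
  have hdense : Dense (⋂ g ∈ s, (MulAction.fixedBy X g)ᶜ) := by
    refine dense_biInter_of_isOpen (fun g _ => ?_) hs fun g hg => ?_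
    · exact (isClosed_eq (continuous_const_smul g) continuous_id).isOpen_compl
    · exact interior_eq_empty_iff_dense_compl.mp (hX g fun h => h1 (h ▸ hg))
  obtain ⟨x, hx⟩ := hdense.nonempty
  exact ⟨x, fun g hg => Set.mem_iInter₂.mp hx g hg⟩

variable [MeasurableSpace X] [BorelSpace X]

theorem pushforward_diracProba (g : G) (x : X) :
    pushforward g (diracProba x) = diracProba (g • x) :=
  Subtype.ext (Measure.map_dirac' (continuous_const_smul g).measurable x)

theorem integral_pushforward (g : G) (μ : ProbabilityMeasure X) (f : C(X, ℝ)) :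
    ∫ x, f x ∂(pushforward g μ : Measure X) = ∫ x, f (g • x) ∂(μ : Measure X) :=
  integral_map (continuous_const_smul g).measurable.aemeasurable
    f.continuous.measurable.aestronglyMeasurable

open scoped Pointwise in
theorem IsBoundaryAction.diracProba_mem (hX : IsBoundaryAction G X)
    {M : Set (ProbabilityMeasure X)} (hM : IsClosed M)
    (hinv : ∀ g : G, ∀ μ ∈ M, pushforward g μ ∈ M) {μ : ProbabilityMeasure X} (hμ : μ ∈ M)
    (hreg : (μ : Measure X).Regular) (x : X) : diracProba x ∈ M := by
  have := hX.minimal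
  have hclosed : IsClosed {y : X | diracProba y ∈ M} := hM.preimage continuous_diracProba
  have hsmul (g : G) : g • {y : X | diracProba y ∈ M} ⊆ {y | diracProba y ∈ M} := by
    rintro _ ⟨y, hy, rfl⟩
    change diracProba (g • y) ∈ M
    rw [← pushforward_diracProba]
    exact hinv g _ hy
  obtain ⟨y, hy⟩ := hX.stronglyProximal μ hreg
  have hyM : diracProba y ∈ M :=
    closure_minimal (Set.range_subset_iff.mpr fun g => hinv g μ hμ) hM hy
  rcases eq_empty_or_univ_of_smul_invariant_closed G hclosed hsmul with hempty | huniv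
  · exact absurd hyM (Set.eq_empty_iff_forall_notMem.mp hempty y)
  · exact huniv.ge (Set.mem_univ x)

end BoundaryAction

theorem exists_probabilityMeasure_integral_eq {X : Type*} [TopologicalSpace X] [CompactSpace X]
    [T2Space X] [MeasurableSpace X] [BorelSpace X] (Λ : C(X, ℝ) →ₚ[ℝ] ℝ) (hΛ : Λ 1 = 1) :
    ∃ μ : ProbabilityMeasure X, (μ : Measure X).Regular ∧
      ∀ f : C(X, ℝ), ∫ x, f x ∂(μ : Measure X) = Λ f := by
  let Λc : CompactlySupportedContinuousMap X ℝ →ₚ[ℝ] ℝ := PositiveLinearMap.mk₀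
    { toFun := fun f => Λ f.toContinuousMap
      map_add' := fun f g => map_add Λ f.toContinuousMap g.toContinuousMap
      map_smul' := fun c f => map_smul Λ c f.toContinuousMap }
    fun f hf => Λ.map_nonneg (show 0 ≤ f.toContinuousMap from hf)
  have hint (f : C(X, ℝ)) : ∫ x, f x ∂(RealRMK.rieszMeasure Λc) = Λ f :=
    RealRMK.integral_rieszMeasure Λc (CompactlySupportedContinuousMap.continuousMapEquiv f)
  have hprob : IsProbabilityMeasure (RealRMK.rieszMeasure Λc) := by
    have h := hint 1
    simp only [hΛ, ContinuousMap.one_apply, integral_const, smul_eq_mul, mul_one] at h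
    exact ⟨(ENNReal.toReal_eq_one_iff _).mp h⟩
  exact ⟨⟨_, hprob⟩, RealRMK.regular_rieszMeasure Λc, hint⟩

/-! ### Covariant positive maps -/

section Covariance

variable {G : Type u} [Group G] {E : Type w} [NormedAddCommGroup E]
  [InnerProductSpace ℂ E] [CompleteSpace E] {X : Type v} [TopologicalSpace X] [MulAction G X]
  [ContinuousConstSMul G X]

/-- The map `x ↦ g • x`, for precomposition in `C(X, ℝ)`. -/
def smulMap (g : G) : C(X, X) := ⟨(g • ·), continuous_const_smul g⟩

/-- A unital positive map from `C(X, ℝ)` to `B(E)` which intertwines the action of `G` on `X` with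
conjugation by `π`. -/
structure IsCovariant (π : UnitaryRep G E) (θ : C(X, ℝ) →ₚ[ℝ] (E →L[ℂ] E)) : Prop where
  map_one : θ 1 = 1
  covariant : ∀ (g : G) (f : C(X, ℝ)),
    (π g : E →L[ℂ] E) * θ (f.comp (smulMap g)) = θ f * (π g : E →L[ℂ] E)

namespace IsCovariant

variable {π : UnitaryRep G E} {θ : C(X, ℝ) →ₚ[ℝ] (E →L[ℂ] E)}

theorem star_mul_mul (hθ : IsCovariant π θ) (g : G) (f : C(X, ℝ)) :
    star (π g : E →L[ℂ] E) * θ f * (π g : E →L[ℂ] E) =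
      θ (f.comp (smulMap g)) := by
  rw [mul_assoc, ← hθ.covariant, ← mul_assoc, Unitary.coe_star_mul_self, one_mul]

/-- Separate `x` from `g • x` by `f : X → [0, 1]`: as `ψ` kills the positive elements `θ f` and
`θ ((1 - f) ∘ g)`, it kills both summands of `π g = θ f * π g + π g * θ ((1 - f) ∘ g)`. -/
theorem apply_eq_zero_of_smul_ne [T4Space X] (hθ : IsCovariant π θ)
    {ψ : WeakDual ℂ (E →L[ℂ] E)} (hψ : IsState ψ) {x : X} (heval : ∀ f, ψ (θ f) = f x) {g : G}
    (hg : g • x ≠ x) : ψ (π g : E →L[ℂ] E) = 0 := by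
  obtain ⟨f, hfx, hfg, hf⟩ := exists_continuous_zero_one_of_isClosed
    (isClosed_singleton (x := x)) (isClosed_singleton (x := g • x))
    (Set.disjoint_singleton.mpr hg.symm)
  have hleft : ψ (θ f * (π g : E →L[ℂ] E)) = 0 := by
    refine map_mul_eq_zero_of_map_left_eq_zero hψ.toPositiveLinearMap
      (θ.map_nonneg fun y => (hf y).1) ?_ _
    exact (heval f).trans (by simp [hfx rfl])
  have hright : ψ ((π g : E →L[ℂ] E) * θ ((1 - f).comp (smulMap g))) = 0 := by
    have hpos : 0 ≤ (1 - f).comp (smulMap g) := fun y => sub_nonneg.mpr (hf (g • y)).2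
    refine map_mul_eq_zero_of_map_right_eq_zero hψ.toPositiveLinearMap (θ.map_nonneg hpos) ?_ _
    exact (heval _).trans (by simp [show f (smulMap g x) = 1 from hfg rfl])
  rwa [hθ.covariant, map_sub, hθ.map_one, sub_mul, one_mul, map_sub, hleft, sub_zero] at hright

variable [CompactSpace X] [T2Space X] [MeasurableSpace X] [BorelSpace X]

open scoped ComplexOrder in
theorem exists_probabilityMeasure (hθ : IsCovariant π θ) {ψ : WeakDual ℂ (E →L[ℂ] E)}
    (hψ : IsState ψ) :
    ∃ μ : ProbabilityMeasure X, (μ : Measure X).Regular ∧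
      ∀ f : C(X, ℝ), ψ (θ f) = ∫ x, f x ∂(μ : Measure X) := by
  let Λ : C(X, ℝ) →ₚ[ℝ] ℝ := PositiveLinearMap.mk₀
    (Complex.reLm ∘ₗ (hψ.toPositiveLinearMap.toLinearMap.restrictScalars ℝ) ∘ₗ θ.toLinearMap)
    fun f hf => (Complex.nonneg_iff.mp (hψ.apply_nonneg (θ.map_nonneg hf))).1
  obtain ⟨μ, hreg, hμ⟩ := exists_probabilityMeasure_integral_eq Λ <|
    show (ψ (θ 1)).re = 1 by rw [hθ.map_one, hψ.map_one, Complex.one_re]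
  have hself (f : C(X, ℝ)) : IsSelfAdjoint (θ f) := by
    rw [← posPart_sub_negPart f, map_sub]
    exact (θ.map_nonneg (posPart_nonneg f)).isSelfAdjoint.sub
      (θ.map_nonneg (negPart_nonneg f)).isSelfAdjoint
  exact ⟨μ, hreg, fun f =>
    Complex.ext (hμ f).symm ((hψ.im_apply_eq_zero (hself f)).trans (Complex.ofReal_im _).symm)⟩

/-- The states of `B(E)` induce a weak*-closed, invariant set of measures on `X`, which therefore
contains the point measures. -/
theorem exists_mem_statesVanishingOn_apply_eq (hθ : IsCovariant π θ) (hX : IsBoundaryAction G X)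
    {S : Set (E →L[ℂ] E)}
    (hS : ∀ g : G, ∀ b ∈ S, star (π g : E →L[ℂ] E) * b * (π g : E →L[ℂ] E) ∈ S)
    (hne : (statesVanishingOn S).Nonempty) (x : X) :
    ∃ ψ ∈ statesVanishingOn S, ∀ f, ψ (θ f) = f x := by
  let M : Set (ProbabilityMeasure X) :=
    {μ | ∃ ψ ∈ statesVanishingOn S, ∀ f, ψ (θ f) = ∫ x, f x ∂(μ : Measure X)}
  have hclosed : IsClosed M := by
    let restrict (ψ : WeakDual ℂ (E →L[ℂ] E)) (f : C(X, ℝ)) : ℂ := ψ (θ f)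
    let integral (μ : ProbabilityMeasure X) (f : C(X, ℝ)) : ℂ := (∫ x, f x ∂(μ : Measure X) : ℝ)
    have hrestrict : Continuous restrict := continuous_pi fun f => WeakDual.eval_continuous _
    have hintegral : Continuous integral := continuous_pi fun f => Complex.continuous_ofReal.comp <|
      ProbabilityMeasure.continuous_integral_boundedContinuousFunction
        (BoundedContinuousFunction.mkOfCompact f)
    have hM : M = integral ⁻¹' (restrict '' statesVanishingOn S) := by
      ext μ
      exact exists_congr fun ψ =>
        and_congr_right' (funext_iff (f := restrict ψ) (g := integral μ)).symm
    exact hM ▸ ((isCompact_statesVanishingOn S).image hrestrict).isClosed.preimage hintegral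
  have hinv (g : G) (μ : ProbabilityMeasure X) (hμ : μ ∈ M) : pushforward g μ ∈ M := by
    obtain ⟨φ, hφ, hφμ⟩ := hμ
    obtain ⟨ψ, hψ, hψφ⟩ := exists_mem_statesVanishingOn_conj hφ (π g) (hS g)
    refine ⟨ψ, hψ, fun f => ?_⟩
    rw [hψφ, hθ.star_mul_mul, hφμ, integral_pushforward]
    rfl
  obtain ⟨φ, hφ⟩ := hne
  obtain ⟨μ, hreg, hμ⟩ := hθ.exists_probabilityMeasure hφ.1
  obtain ⟨ψ, hψ, heval⟩ := hX.diracProba_mem hclosed hinv ⟨φ, hφ, hμ⟩ hreg x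
  exact ⟨ψ, hψ, fun f => (heval f).trans (congrArg Complex.ofReal (integral_dirac f x))⟩

/-- Finitely many elements `g ≠ 1` always move a common point, and compactness of
`statesVanishingOn S` takes care of all of them at once. -/
theorem exists_isTraceState (hθ : IsCovariant π θ) (hX : IsBoundaryAction G X)
    (hfree : IsTopologicallyFree G X) {S : Set (E →L[ℂ] E)}
    (hS : ∀ g : G, ∀ b ∈ S, star (π g : E →L[ℂ] E) * b * (π g : E →L[ℂ] E) ∈ S)
    (hne : (statesVanishingOn S).Nonempty) : ∃ ψ ∈ statesVanishingOn S, IsTraceState π ψ := by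
  have := hX.nonempty
  obtain ⟨ψ, hψ, htrace⟩ := (isCompact_statesVanishingOn S).inter_iInter_nonempty
    (fun g : {g : G // g ≠ 1} => {ψ : WeakDual ℂ (E →L[ℂ] E) | ψ (π g : E →L[ℂ] E) = 0})
    (fun g => isClosed_eq (WeakDual.eval_continuous _) continuous_const) fun s => by
      obtain ⟨x, hx⟩ := hfree.exists_forall_mem_smul_ne
        (s := Subtype.val '' (s : Set {g : G // g ≠ 1})) (s.countable_toSet.image _) (by simp)
      obtain ⟨ψ, hψ, heval⟩ := hθ.exists_mem_statesVanishingOn_apply_eq hX hS hne x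
      exact ⟨ψ, hψ, Set.mem_iInter₂.mpr fun g hg =>
        hθ.apply_eq_zero_of_smul_ne hψ.1 heval (hx g ⟨g, hg, rfl⟩)⟩
  exact ⟨ψ, hψ, hψ.1, fun g hg => Set.mem_iInter.mp htrace ⟨g, hg⟩⟩

theorem exists_isTraceState_of_ne_top [Nontrivial E] (hθ : IsCovariant π θ)
    (hX : IsBoundaryAction G X) (hfree : IsTopologicallyFree G X) {I : TwoSidedIdeal π.cstar}
    (hI : I ≠ ⊤) : ∃ ψ, IsTraceState π ψ ∧ ∀ a ∈ I, ψ (a : E →L[ℂ] E) = 0 := by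
  have : CompleteSpace π.cstar.toSubalgebra := inferInstanceAs (CompleteSpace π.cstar)
  have hconj (g : G) (b) (hb : b ∈ Subtype.val '' (I : Set π.cstar)) :
      star (π g : E →L[ℂ] E) * b * (π g : E →L[ℂ] E) ∈ Subtype.val '' (I : Set π.cstar) := by
    obtain ⟨a, ha, rfl⟩ := hb
    exact ⟨star (π.toCstar g) * a * π.toCstar g,
      I.mul_mem_right _ _ (I.mul_mem_left _ _ ha), rfl⟩
  obtain ⟨ψ, hψ, htrace⟩ := hθ.exists_isTraceState hX hfree hconj
    (nonempty_statesVanishingOn π.cstar.toSubalgebra hI)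
  exact ⟨ψ, htrace, fun a ha => hψ.2 a ⟨a, ha, rfl⟩⟩

end IsCovariant

end Covariance

/-! ### The Poisson transform on an induced representation -/

section Multiplication

variable {G : Type u} [Group G] {H : Subgroup G} {K : Type w} [NormedAddCommGroup K]
  [InnerProductSpace ℂ K] [CompleteSpace K] (σ : UnitaryRep H K)

namespace IndSpace

variable {σ}

theorem summable_norm_sq (F : IndSpace σ) : Summable fun c : G ⧸ H => ‖F c.out‖ ^ 2 :=
  F.2.2

theorem ext_clm {S T : IndSpace σ →L[ℂ] IndSpace σ} (h : ∀ F x, S F x = T F x) : S = T :=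
  ContinuousLinearMap.ext fun F => ext (h F)

end IndSpace

variable {m : G ⧸ H → ℝ} {C : ℝ}

theorem norm_smul_sq_le (hm : ∀ c, |m c| ≤ C) (F : IndSpace σ) (x : G) :
    ‖(m x : ℂ) • F x‖ ^ 2 ≤ C ^ 2 * ‖F x‖ ^ 2 := by
  rw [norm_smul, Complex.norm_real, mul_pow]
  exact mul_le_mul_of_nonneg_right (pow_le_pow_left₀ (abs_nonneg _) (hm x) 2) (sq_nonneg _)

theorem summable_norm_smul_sq (hm : ∀ c, |m c| ≤ C) (F : IndSpace σ) :
    Summable fun c : G ⧸ H => ‖(m (c.out : G ⧸ H) : ℂ) • F c.out‖ ^ 2 :=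
  .of_nonneg_of_le (fun _ => sq_nonneg _) (fun c => norm_smul_sq_le σ hm F c.out)
    (F.summable_norm_sq.mul_left (C ^ 2))

/-- Multiplication by a bounded function on `G ⧸ H`, as an operator on the space of
`Ind_H^G σ`. -/
def mulOp (m : G ⧸ H → ℝ) (hm : ∀ c, |m c| ≤ C) : IndSpace σ →L[ℂ] IndSpace σ :=
  LinearMap.mkContinuous
    { toFun := fun F => ⟨fun x => (m x : ℂ) • F x, fun x h => by
        change (m ↑(x * (h : G)) : ℂ) • F (x * h) = (σ h⁻¹ : K →L[ℂ] K) ((m x : ℂ) • F x)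
        rw [QuotientGroup.mk_mul_of_mem x h.2, F.map_mul_right, map_smul],
        summable_norm_smul_sq σ hm F⟩
      map_add' := fun F₁ F₂ => IndSpace.ext fun x => smul_add (m x : ℂ) (F₁ x) (F₂ x)
      map_smul' := fun a F => IndSpace.ext fun x => smul_comm (m x : ℂ) a (F x) } C fun F => by
    have hC : 0 ≤ C := (abs_nonneg _).trans (hm ((1 : G) : G ⧸ H))
    rw [← sq_le_sq₀ (norm_nonneg _) (mul_nonneg hC (norm_nonneg _)), mul_pow,
      IndSpace.norm_sq_eq, IndSpace.norm_sq_eq, ← tsum_mul_left]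
    exact (summable_norm_smul_sq σ hm F).tsum_le_tsum
      (fun c => norm_smul_sq_le σ hm F c.out) (F.summable_norm_sq.mul_left (C ^ 2))

theorem mulOp_apply (hm : ∀ c, |m c| ≤ C) (F : IndSpace σ) (x : G) :
    mulOp σ m hm F x = (m x : ℂ) • F x := rfl

theorem inner_mulOp_self (hm : ∀ c, |m c| ≤ C) (F : IndSpace σ) :
    ⟪mulOp σ m hm F, F⟫_ℂ = (∑' c : G ⧸ H, m c * ‖F c.out‖ ^ 2 : ℝ) := by
  rw [IndSpace.inner_def, Complex.ofReal_tsum]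
  refine tsum_congr fun c => ?_
  rw [mulOp_apply, inner_smul_left, Complex.conj_ofReal, QuotientGroup.out_eq',
    inner_self_eq_norm_sq_to_K, Complex.ofReal_mul, Complex.ofReal_pow]
  rfl

theorem mulOp_nonneg (hm : ∀ c, |m c| ≤ C) (h0 : ∀ c, 0 ≤ m c) : 0 ≤ mulOp σ m hm := by
  rw [ContinuousLinearMap.nonneg_iff_isPositive, ContinuousLinearMap.isPositive_iff_complex]
  intro F
  rw [inner_mulOp_self]
  exact ⟨rfl, tsum_nonneg fun c => mul_nonneg (h0 c) (sq_nonneg _)⟩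

end Multiplication

section Poisson

variable {G : Type u} [Group G] {H : Subgroup G} {K : Type w} [NormedAddCommGroup K]
  [InnerProductSpace ℂ K] [CompleteSpace K] (σ : UnitaryRep H K)
  {X : Type v} [TopologicalSpace X] [MeasurableSpace X] [MulAction G X]
  {ν : ProbabilityMeasure X}

/-- The Poisson transform `xH ↦ ∫ f(xy) dν(y)`, for `ν` an `H`-invariant measure. It is written in
terms of the representatives `Quotient.out`; see `poisson_mk`. -/
def poisson (ν : ProbabilityMeasure X) (f : C(X, ℝ)) (c : G ⧸ H) : ℝ :=
  ∫ y, f (c.out • y) ∂(ν : Measure X)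

theorem abs_poisson_le [CompactSpace X] (f : C(X, ℝ)) (c : G ⧸ H) : |poisson ν f c| ≤ ‖f‖ := by
  have h := norm_integral_le_of_norm_le_const (μ := (ν : Measure X))
    (.of_forall fun y => f.norm_coe_le_norm (c.out • y))
  rwa [probReal_univ, mul_one, Real.norm_eq_abs] at h

variable [BorelSpace X] [ContinuousConstSMul G X]

theorem poisson_mk (hν : ∀ h ∈ H, pushforward h ν = ν) (f : C(X, ℝ)) (x : G) :
    poisson ν f (x : G ⧸ H) = ∫ y, f (x • y) ∂(ν : Measure X) := by
  obtain ⟨h, hh⟩ := QuotientGroup.mk_out_eq_mul H x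
  simp only [poisson, hh, mul_smul]
  exact (integral_pushforward (h : G) ν (f.comp (smulMap x))).symm.trans (by rw [hν h h.2]; rfl)

theorem poisson_comp_smulMap (hν : ∀ h ∈ H, pushforward h ν = ν) (f : C(X, ℝ)) (g x : G) :
    poisson ν (f.comp (smulMap g)) ((g⁻¹ * x : G) : G ⧸ H) = poisson ν f (x : G ⧸ H) := by
  rw [poisson_mk hν, poisson_mk hν]
  refine integral_congr_ae (.of_forall fun y => congrArg f ?_)
  exact (mul_smul g (g⁻¹ * x) y).symm.trans (by rw [mul_inv_cancel_left])

variable [CompactSpace X]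

theorem poisson_add (f₁ f₂ : C(X, ℝ)) (c : G ⧸ H) :
    poisson ν (f₁ + f₂) c = poisson ν f₁ c + poisson ν f₂ c :=
  have hint (f : C(X, ℝ)) : Integrable (fun y => f (c.out • y)) (ν : Measure X) :=
    (BoundedContinuousFunction.mkOfCompact (f.comp (smulMap c.out))).integrable _
  integral_add (hint f₁) (hint f₂)

variable (ν) in
/-- The Poisson transform, followed by the action of functions on `G ⧸ H` on the space of
`Ind_H^G σ` by multiplication. -/
def poissonOp : C(X, ℝ) →ₚ[ℝ] (IndSpace σ →L[ℂ] IndSpace σ) :=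
  PositiveLinearMap.mk₀
    { toFun := fun f => mulOp σ (poisson ν f) (abs_poisson_le f)
      map_add' := fun f₁ f₂ => IndSpace.ext_clm fun F x => by
        change (poisson ν (f₁ + f₂) (x : G ⧸ H) : ℂ) • F x =
          (poisson ν f₁ (x : G ⧸ H) : ℂ) • F x + (poisson ν f₂ (x : G ⧸ H) : ℂ) • F x
        rw [poisson_add, Complex.ofReal_add, add_smul]
      map_smul' := fun r f => IndSpace.ext_clm fun F x => by
        change (poisson ν (r • f) (x : G ⧸ H) : ℂ) • F x =
          (r : ℂ) • (poisson ν f (x : G ⧸ H) : ℂ) • F x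
        rw [← mul_smul, ← Complex.ofReal_mul]
        exact congrArg (fun t : ℝ => (t : ℂ) • F x) (integral_const_mul r _) }
    fun f hf => mulOp_nonneg σ (abs_poisson_le f) fun c => integral_nonneg fun y => hf _

theorem poissonOp_apply (f : C(X, ℝ)) (F : IndSpace σ) (x : G) :
    poissonOp σ ν f F x = (poisson ν f (x : G ⧸ H) : ℂ) • F x := rfl

theorem isCovariant_poissonOp (hν : ∀ h ∈ H, pushforward h ν = ν) :
    IsCovariant (inducedRep σ) (poissonOp σ ν) where
  map_one := IndSpace.ext_clm fun F x => by
    rw [poissonOp_apply]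
    simp [poisson]
  covariant g f := IndSpace.ext_clm fun F x => by
    change (poisson ν (f.comp (smulMap g)) ((g⁻¹ * x : G) : G ⧸ H) : ℂ) • F (g⁻¹ * x) =
      (poisson ν f (x : G ⧸ H) : ℂ) • F (g⁻¹ * x)
    rw [poisson_comp_smulMap hν]

end Poisson

section Kernel

variable {G : Type u} [Group G] {E : Type w} [NormedAddCommGroup E]
  [InnerProductSpace ℂ E] [CompleteSpace E] {π : UnitaryRep G E}

variable (π) in
theorem bot_ne_top_cstar [Nontrivial E] : (⊥ : TwoSidedIdeal π.cstar) ≠ ⊤ := fun h =>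
  one_ne_zero ((TwoSidedIdeal.mem_bot _).mp (h ▸ trivial : (1 : π.cstar) ∈ ⊥))

variable {Φ : π.cstar →⋆ₐ[ℂ] (regularRep G).cstar}

theorem map_toCstar (hΦ : ∀ f, Φ (π.algHomCstar f) = (regularRep G).algHomCstar f) (g : G) :
    Φ (π.toCstar g) = (regularRep G).toCstar g := by
  rw [← UnitaryRep.algHomCstar_single_one, hΦ, UnitaryRep.algHomCstar_single_one]

theorem surjective_regularRep
    (hΦ : ∀ f, Φ (π.algHomCstar f) = (regularRep G).algHomCstar f) : Function.Surjective Φ := by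
  refine surjective_of_denseRange Φ fun b =>
    closure_mono ?_ ((regularRep G).denseRange_algHomCstar b)
  rintro _ ⟨f, rfl⟩
  exact ⟨_, hΦ f⟩

open scoped CStarAlgebra in
theorem isClosed_ker (Φ : π.cstar →⋆ₐ[ℂ] (regularRep G).cstar) :
    IsClosed (TwoSidedIdeal.ker Φ : Set π.cstar) := by
  have hker : (TwoSidedIdeal.ker Φ : Set π.cstar) = Φ ⁻¹' {0} :=
    Set.ext fun a => TwoSidedIdeal.mem_ker Φ
  exact hker ▸ isClosed_singleton.preimage (map_continuous Φ)

theorem ker_ne_top (Φ : π.cstar →⋆ₐ[ℂ] (regularRep G).cstar) : TwoSidedIdeal.ker Φ ≠ ⊤ := by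
  intro h
  have hone : (1 : π.cstar) ∈ TwoSidedIdeal.ker Φ := h ▸ trivial
  rw [TwoSidedIdeal.mem_ker, map_one] at hone
  exact one_ne_zero (congrArg Subtype.val hone)

theorem isGreatest_ker (hΦ : ∀ f, Φ (π.algHomCstar f) = (regularRep G).algHomCstar f)
    (htrace : ∀ I : TwoSidedIdeal π.cstar, I ≠ ⊤ →
      ∃ ψ, IsTraceState π ψ ∧ ∀ a ∈ I, ψ (a : E →L[ℂ] E) = 0) :
    IsGreatest {I : TwoSidedIdeal π.cstar | IsClosed (I : Set π.cstar) ∧ I ≠ ⊤}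
      (TwoSidedIdeal.ker Φ) := by
  refine ⟨⟨isClosed_ker Φ, ker_ne_top Φ⟩, fun I hI a ha => ?_⟩
  obtain ⟨ψ, hψ, hψI⟩ := htrace I hI.2
  exact (TwoSidedIdeal.mem_ker Φ).mpr (hψ.map_eq_zero_of_mem hΦ hψI ha)

end Kernel

section WeaklyParabolic

variable {G : Type u} [Group G] {H : Subgroup G} {K : Type w} [NormedAddCommGroup K]
  [InnerProductSpace ℂ K] [CompleteSpace K] (σ : UnitaryRep H K)

theorem IndSpace.nontrivial [Nontrivial K] : Nontrivial (IndSpace σ) :=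
  toLp_surjective.nontrivial

theorem IsWeaklyParabolic.exists_isTraceState [Nontrivial K] (hH : IsWeaklyParabolic.{u, v} H)
    {I : TwoSidedIdeal (inducedRep σ).cstar} (hI : I ≠ ⊤) :
    ∃ ψ, IsTraceState (inducedRep σ) ψ ∧
      ∀ a ∈ I, ψ (a : IndSpace σ →L[ℂ] IndSpace σ) = 0 := by
  obtain ⟨X, _, _, _, _, _, _, _, hX, hfree, ν, -, hν⟩ := hH
  have := IndSpace.nontrivial σ
  exact (isCovariant_poissonOp (X := X) σ hν).exists_isTraceState_of_ne_top hX hfree hI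

end WeaklyParabolic

end IndRep

end

theorem mainTheorem2_general {G : Type u} [Group G] (H : Subgroup G)
    (hH : IndRep.IsWeaklyParabolic.{u, v} H)
    {K : Type w} [NormedAddCommGroup K] [InnerProductSpace ℂ K] [CompleteSpace K]
    [Nontrivial K] (σ : IndRep.UnitaryRep H K) :
    ∃ Φ : (IndRep.inducedRep σ).cstar →⋆ₐ[ℂ] (IndRep.regularRep G).cstar,
      (∀ g : G, Φ ((IndRep.inducedRep σ).toCstar g) = (IndRep.regularRep G).toCstar g) ∧
      Function.Surjective Φ ∧
      IsGreatest {I : TwoSidedIdeal (IndRep.inducedRep σ).cstar |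
        IsClosed (I : Set (IndRep.inducedRep σ).cstar) ∧ I ≠ ⊤} (TwoSidedIdeal.ker Φ) := by
  have := IndRep.IndSpace.nontrivial σ
  obtain ⟨ψ, hψ, -⟩ := hH.exists_isTraceState σ (IndRep.bot_ne_top_cstar _)
  obtain ⟨Φ, hΦ⟩ := hψ.exists_starAlgHom_regularRep
  exact ⟨Φ, IndRep.map_toCstar hΦ, IndRep.surjective_regularRep hΦ,
    IndRep.isGreatest_ker hΦ fun I hI => hH.exists_isTraceState σ hI⟩

theorem mainTheorem2 {G : Type u} [Group G] [Countable G] (H : Subgroup G)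
    (hH : IndRep.IsWeaklyParabolic.{u, v} H)
    {K : Type w} [NormedAddCommGroup K] [InnerProductSpace ℂ K] [CompleteSpace K]
    [Nontrivial K] (σ : IndRep.UnitaryRep H K) :
    ∃ Φ : (IndRep.inducedRep σ).cstar →⋆ₐ[ℂ] (IndRep.regularRep G).cstar,
      (∀ g : G, Φ ((IndRep.inducedRep σ).toCstar g) = (IndRep.regularRep G).toCstar g) ∧
      Function.Surjective Φ ∧
      IsGreatest {I : TwoSidedIdeal (IndRep.inducedRep σ).cstar |
        IsClosed (I : Set (IndRep.inducedRep σ).cstar) ∧ I ≠ ⊤} (TwoSidedIdeal.ker Φ) :=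
  mainTheorem2_general H hH σ
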